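/- Let $\mathfrak h$ be a separable infinite-dimensional complex Hilbert space and let $n\ge 0$ be an integer. For a Hilbert space $\mathfrak k$ let ${}^{\rm w}\mathbb U(\mathfrak k)$ be the group of unitary operators of $\mathfrak k$ with the weak operator topology, and let ${}^{\rm w}\mathbb G_n(\mathfrak h)$ be the set of orthogonal projections of rank $n$ on $\mathfrak h$ with the weak operator topology. Let $P_0\in\mathbb G_n(\mathfrak h)$ be any reference projection, with range $\mathfrak v_0$ and orthogonal complement $\mathfrak v_0^\perp$, and regard $\mathbb U(\mathfrak v_0)\times\mathbb U(\mathfrak v_0^\perp)$ as the subgroup of $\mathbb U(\mathfrak h)$ of the unitaries $a\oplus b$ on $\mathfrak h=\mathfrak v_0\oplus\mathfrak v_0^\perp$. Then the map $\pi:{}^{\rm w}\mathbb U(\mathfrak h)\to{}^{\rm w}\mathbb G_n(\mathfrak h)$, $\pi(U)=UP_0U^*$, is a locally trivial fibre bundle with typical fibre ${}^{\rm w}\mathbb U(\mathfrak v_0)\times{}^{\rm w}\mathbb U(\mathfrak v_0^\perp)$, and $\pi$ induces a homeomorphism $${}^{\rm w}\mathbb U(\mathfrak h)\big/\left[{}^{\rm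 w}\mathbb U(\mathfrak v_0)\times{}^{\rm w}\mathbb U(\mathfrak v_0^\perp)\right]\;\simeq\;{}^{\rm w}\mathbb G_n(\mathfrak h).$$ Moreover, on each of $\mathbb U(\mathfrak h)$, $\mathbb U(\mathfrak v_0)$, $\mathbb U(\mathfrak v_0^\perp)$ and $\mathbb G_n(\mathfrak h)$ the weak operator topology coincides with the strong operator topology, so the same holds with the strong topology throughout. -/

import Mathlib

noncomputable section

/-- The group `𝕌(K)` of unitary operators of a Hilbert space `K`. It is a type copy of Mathlib's
`unitary (K →L[ℂ] K)`, so that it does not inherit the topology of the operator norm. -/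
def UnitaryOp (K : Type*) [NormedAddCommGroup K] [InnerProductSpace ℂ K] [CompleteSpace K] :
    Type _ :=
  unitary (K →L[ℂ] K)

namespace UnitaryOp

variable {K : Type*} [NormedAddCommGroup K] [InnerProductSpace ℂ K] [CompleteSpace K]

instance instGroup : Group (UnitaryOp K) := inferInstanceAs (Group (unitary (K →L[ℂ] K)))

/-- The operator underlying a unitary. -/
def op (U : UnitaryOp K) : K →L[ℂ] K := (show unitary (K →L[ℂ] K) from U).1

theorem op_mem (U : UnitaryOp K) : U.op ∈ unitary (K →L[ℂ] K) :=
  (show unitary (K →L[ℂ] K) from U).2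

/-- The weak topology on the unitary group, that is, the subspace topology of the weak operator
topology. -/
instance instTopologicalSpace : TopologicalSpace (UnitaryOp K) :=
  TopologicalSpace.induced (fun U => ContinuousLinearMapWOT.ofCLM (σ := RingHom.id ℂ) U.op)
    inferInstance

variable (K) in
/-- The strong topology on the unitary group, that is, the subspace topology of the topology of
pointwise norm convergence of operators. -/
abbrev strongTopology : TopologicalSpace (UnitaryOp K) :=
  TopologicalSpace.induced
    (fun U => ContinuousLinearMap.toPointwiseConvergenceCLM ℂ (RingHom.id ℂ) K K U.op)
    inferInstance

end UnitaryOp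

/-- The Hilbert Grassmannian `𝔾ₙ(K)`: the orthogonal projections of `K` of rank `n`.
(`LinearMap.rank` is the cardinal-valued dimension of the range, so an operator of infinite rank is
not of rank `0`.) -/
def Grassmannian (K : Type*) [NormedAddCommGroup K] [InnerProductSpace ℂ K] [CompleteSpace K]
    (n : ℕ) : Type _ :=
  {P : K →L[ℂ] K // IsStarProjection P ∧ LinearMap.rank (P : K →ₗ[ℂ] K) = n}

namespace Grassmannian

variable {K : Type*} [NormedAddCommGroup K] [InnerProductSpace ℂ K] [CompleteSpace K] {n : ℕ}

/-- The operator underlying a point of the Grassmannian. -/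
def op (P : Grassmannian K n) : K →L[ℂ] K := P.1

/-- The weak topology on the Grassmannian, that is, the subspace topology of the weak operator
topology. -/
instance instTopologicalSpace : TopologicalSpace (Grassmannian K n) :=
  TopologicalSpace.induced (fun P => ContinuousLinearMapWOT.ofCLM (σ := RingHom.id ℂ) P.op)
    inferInstance

variable (K n) in
/-- The strong topology on the Grassmannian, that is, the subspace topology of the topology of
pointwise norm convergence of operators. -/
abbrev strongTopology : TopologicalSpace (Grassmannian K n) :=
  TopologicalSpace.induced
    (fun P => ContinuousLinearMap.toPointwiseConvergenceCLM ℂ (RingHom.id ℂ) K K P.op)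
    inferInstance

/-- The `n`-dimensional subspace that is the range of a rank `n` projection. -/
def ran (P : Grassmannian K n) : Submodule ℂ K := LinearMap.range (P.op : K →ₗ[ℂ] K)

instance (P : Grassmannian K n) : FiniteDimensional ℂ P.ran := by
  have h : Module.rank ℂ P.ran = n := P.2.2
  exact Module.rank_lt_aleph0_iff.mp (h ▸ Cardinal.natCast_lt_aleph0)

theorem conj_mem (P : Grassmannian K n) (U : UnitaryOp K) :
    IsStarProjection (U.op * P.op * star U.op) ∧
      LinearMap.rank ((U.op * P.op * star U.op : K →L[ℂ] K) : K →ₗ[ℂ] K) = n := by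
  have h1 : star U.op * U.op = 1 := (Unitary.mem_iff.mp U.op_mem).1
  have hP : IsStarProjection P.op := P.2.1
  refine ⟨⟨?_, ?_⟩, ?_⟩
  · have : P.op * P.op = P.op := hP.isIdempotentElem
    change _ * _ = _
    calc U.op * P.op * star U.op * (U.op * P.op * star U.op)
        = U.op * P.op * (star U.op * U.op) * P.op * star U.op := by simp only [mul_assoc]
      _ = U.op * (P.op * P.op) * star U.op := by rw [h1]; simp only [mul_assoc, one_mul]
      _ = _ := by rw [this]
  · have : star P.op = P.op := hP.isSelfAdjoint
    change star _ = _
    simp only [star_mul, star_star, this, mul_assoc]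
  · have key : ∀ A B C : K →L[ℂ] K, LinearMap.rank ((A * B * C : K →L[ℂ] K) : K →ₗ[ℂ] K)
        ≤ LinearMap.rank (B : K →ₗ[ℂ] K) := fun A B C =>
      (LinearMap.rank_comp_le_left (C : K →ₗ[ℂ] K) ((A * B : K →L[ℂ] K) : K →ₗ[ℂ] K)).trans
        (LinearMap.rank_comp_le_right (B : K →ₗ[ℂ] K) (A : K →ₗ[ℂ] K))
    have hr : LinearMap.rank (P.op : K →ₗ[ℂ] K) = n := P.2.2
    rw [← hr]
    refine le_antisymm (key _ _ _) ?_
    have e : P.op = star U.op * (U.op * P.op * star U.op) * U.op := by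
      calc P.op = (star U.op * U.op) * P.op * (star U.op * U.op) := by rw [h1]; simp
        _ = _ := by simp only [mul_assoc]
    calc LinearMap.rank (P.op : K →ₗ[ℂ] K)
        = LinearMap.rank
            ((star U.op * (U.op * P.op * star U.op) * U.op : K →L[ℂ] K) : K →ₗ[ℂ] K) := by rw [← e]
      _ ≤ _ := key _ _ _

/-- The map `U ↦ U P U*` from the unitary group to the Grassmannian. -/
def orbitMap (P : Grassmannian K n) (U : UnitaryOp K) : Grassmannian K n :=
  ⟨U.op * P.op * star U.op, conj_mem P U⟩

end Grassmannian

section BlockDiagonal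

open ContinuousLinearMap

set_option linter.unusedSectionVars false

variable {K : Type*} [NormedAddCommGroup K] [InnerProductSpace ℂ K] [CompleteSpace K]
  (v : Submodule ℂ K) [CompleteSpace v]

/-- The operator `a ⊕ b` on `K = v ⊕ vᗮ`. -/
def blockOp (a : v →L[ℂ] v) (b : vᗮ →L[ℂ] vᗮ) : K →L[ℂ] K :=
  v.subtypeL ∘L a ∘L v.orthogonalProjectionOnto + vᗮ.subtypeL ∘L b ∘L vᗮ.orthogonalProjectionOnto

theorem blockOp_one : blockOp v 1 1 = 1 := by
  ext x
  simp [blockOp]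

theorem blockOp_mul (a a' : v →L[ℂ] v) (b b' : vᗮ →L[ℂ] vᗮ) :
    blockOp v a b * blockOp v a' b' = blockOp v (a * a') (b * b') := by
  ext x
  have h : ∀ y : v, vᗮ.orthogonalProjectionOnto (y : K) = 0 := fun y =>
    Submodule.orthogonalProjectionOnto_orthogonal_apply_eq_zero y.2
  have h' : ∀ y : vᗮ, v.orthogonalProjectionOnto (y : K) = 0 := fun y =>
    Submodule.orthogonalProjectionOnto_apply_of_mem_orthogonal y.2
  simp [blockOp, h, h']

theorem star_blockOp (a : v →L[ℂ] v) (b : vᗮ →L[ℂ] vᗮ) :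
    star (blockOp v a b) = blockOp v (star a) (star b) := by
  simp only [blockOp, star_eq_adjoint, map_add, adjoint_comp, Submodule.adjoint_subtypeL,
    Submodule.adjoint_orthogonalProjectionOnto]
  rfl

/-- The inclusion `𝕌(v) × 𝕌(vᗮ) → 𝕌(K)`, `(a, b) ↦ a ⊕ b`. -/
def blockHom : UnitaryOp v × UnitaryOp vᗮ →* UnitaryOp K where
  toFun p := ⟨blockOp v p.1.op p.2.op, by
    have h1 := Unitary.mem_iff.mp p.1.op_mem
    have h2 := Unitary.mem_iff.mp p.2.op_mem
    rw [Unitary.mem_iff, star_blockOp, blockOp_mul, blockOp_mul, h1.1, h1.2, h2.1, h2.2,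
      blockOp_one]
    exact ⟨rfl, rfl⟩⟩
  map_one' := Subtype.ext (blockOp_one v)
  map_mul' p q := Subtype.ext (blockOp_mul v p.1.op q.1.op p.2.op q.2.op).symm

/-- The subgroup `𝕌(v) × 𝕌(vᗮ)` of `𝕌(K)`: the unitaries of the form `a ⊕ b`. -/
def blockSubgroup : Subgroup (UnitaryOp K) := (blockHom v).range

end BlockDiagonal

/-- `proj : Z → B` is a locally trivial fibre bundle with typical fibre `F`: it is continuous, and
each point of `B` has an open neighbourhood `O` with a homeomorphism `proj ⁻¹' O ≃ O × F` over `O`. -/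
def IsLocallyTrivialFibreBundle {Z B : Type*} (F : Type*) [TopologicalSpace Z] [TopologicalSpace B]
    [TopologicalSpace F] (proj : Z → B) : Prop :=
  Continuous proj ∧ ∀ b : B, ∃ e : Bundle.Trivialization F proj, b ∈ e.baseSet

end

/-!
Weak and strong topology agree on unitaries and on projections because the norms
`‖U x‖ = ‖x‖` and `‖P x‖ = √⟪x, P x⟫` are weakly continuous, and weak convergence of vectors
together with convergence of the norms is norm convergence
(`continuous_of_continuous_inner_of_continuous_norm`). In particular `UnitaryOp K` is a topological
group.

The rest follows from the existence of continuous local sections of the orbit map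
`U ↦ U P₀ U*` (`Grassmannian.exists_local_section`), whose fibres are the left cosets of the
stabilizer `𝕌(v₀) × 𝕌(v₀ᗮ)` of `P₀`. That stabilizer is embedded in `𝕌(h)` by `isEmbedding_blockHom`,
so a section over an open set gives a trivialization over it (`exists_trivialization_of_section`),
and local sections give continuity of the inverse of the bijection from the quotient
(`exists_quotient_homeomorph_of_local_sections`).

For the local sections, the point is that on projections of a fixed finite rank the weak operator
topology is even the norm topology (`Grassmannian.continuous_op`). Hence `‖Q - P‖ < 1` defines an open
neighbourhood of `P`, on which the direct rotation, the unitary part of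
`Q P + (1 - Q) (1 - P)`, is a norm continuous family of unitaries carrying `P` to `Q`
(`directRotation_mem_unitary`, `directRotation_mul`, `continuousOn_directRotation`). Composing with a
fixed unitary that carries `P₀` to `P` (`Grassmannian.exists_orbitMap_eq`) gives the section.
-/

noncomputable section

open scoped InnerProductSpace Topology

/-! ### The direct rotation between two close projections -/

section StarProjection

variable {A : Type*} [CStarAlgebra A] {p q : A}

/-- The element `q p + (1 - q) (1 - p)`, which intertwines the projections `p` and `q`: it maps the
range of `p` into that of `q`, and the kernel of `p` into that of `q`. -/
def intertwiner (p q : A) : A := q * p + (1 - q) * (1 - p)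

theorem intertwiner_mul (hp : IsStarProjection p) (hq : IsStarProjection q) :
    intertwiner p q * p = q * intertwiner p q := by
  have hp1 : p * p = p := hp.isIdempotentElem
  have hq1 : q * q = q := hq.isIdempotentElem
  simp only [intertwiner, mul_add, add_mul, mul_assoc, hp1, hp.one_sub_mul_self]
  simp only [← mul_assoc, hq1, hq.mul_one_sub_self]
  simp

theorem star_intertwiner (hp : IsStarProjection p) (hq : IsStarProjection q) :
    star (intertwiner p q) = intertwiner q p := by
  simp [intertwiner, hp.isSelfAdjoint.star_eq, hq.isSelfAdjoint.star_eq]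

/-- Since `intertwiner q p` is the adjoint of `intertwiner p q` and the right-hand side is symmetric
in `p` and `q`, this shows that the intertwiner is normal. -/
theorem intertwiner_mul_intertwiner (hp : IsStarProjection p) (hq : IsStarProjection q) :
    intertwiner q p * intertwiner p q = 1 - (q - p) * (q - p) := by
  have hp1 : p * p = p := hp.isIdempotentElem
  have hq1 : q * q = q := hq.isIdempotentElem
  have hq2 : ∀ x, q * (q * x) = q * x := fun x => by rw [← mul_assoc, hq1]
  simp only [intertwiner, mul_add, add_mul, mul_sub, sub_mul, mul_assoc, hp1, hq1, hq2,
    mul_one, one_mul]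
  abel

theorem commute_sub_mul_sub (hp : IsStarProjection p) (hq : IsStarProjection q) :
    Commute (1 - (q - p) * (q - p)) p := by
  rw [← intertwiner_mul_intertwiner hp hq]
  change _ * _ = _ * _
  rw [mul_assoc, intertwiner_mul hp hq, ← mul_assoc, intertwiner_mul hq hp, mul_assoc]

theorem commute_sub_mul_sub_intertwiner (hp : IsStarProjection p) (hq : IsStarProjection q) :
    Commute (1 - (q - p) * (q - p)) (intertwiner p q) := by
  have h : 1 - (q - p) * (q - p) = intertwiner p q * intertwiner q p := by
    rw [intertwiner_mul_intertwiner hq hp, ← neg_sub q p, neg_mul_neg]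
  change _ * _ = _ * _
  conv_lhs => rw [h]
  rw [mul_assoc, intertwiner_mul_intertwiner hp hq]

variable [PartialOrder A] [StarOrderedRing A]

theorem isStrictlyPositive_one_sub_sq (hp : IsStarProjection p) (hq : IsStarProjection q)
    (h : ‖q - p‖ < 1) : IsStrictlyPositive (1 - (q - p) * (q - p)) := by
  rw [IsStrictlyPositive.iff_of_unital]
  refine ⟨?_, isUnit_one_sub_of_norm_lt_one ?_⟩
  · rw [← intertwiner_mul_intertwiner hp hq, ← star_intertwiner hp hq]
    exact star_mul_self_nonneg _
  · calc ‖(q - p) * (q - p)‖ ≤ ‖q - p‖ * ‖q - p‖ := norm_mul_le _ _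
      _ < 1 := by nlinarith [norm_nonneg (q - p)]

/-- The direct rotation from `p` to `q`: the unitary part `A (A* A) ^ (-1/2)` of the intertwiner `A`,
where `A* A = 1 - (q - p)²`. It is unitary if `‖q - p‖ < 1`; otherwise `A` need not be invertible and
the power is a junk value. -/
def directRotation (p q : A) : A :=
  intertwiner p q * (1 - (q - p) * (q - p)) ^ (-(1 / 2) : ℝ)

theorem directRotation_mul (hp : IsStarProjection p) (hq : IsStarProjection q) :
    directRotation p q * p = q * directRotation p q := by
  have hc : Commute ((1 - (q - p) * (q - p)) ^ (-(1 / 2) : ℝ)) p :=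
    (commute_sub_mul_sub hp hq).cfc_nnreal _
  rw [directRotation, mul_assoc, hc.eq, ← mul_assoc, intertwiner_mul hp hq, mul_assoc]

theorem directRotation_mem_unitary (hp : IsStarProjection p) (hq : IsStarProjection q)
    (h : ‖q - p‖ < 1) : directRotation p q ∈ unitary A := by
  have hB := isStrictlyPositive_one_sub_sq hp hq h
  have hAA := intertwiner_mul_intertwiner hp hq
  have hAA' := intertwiner_mul_intertwiner hq hp
  rw [← neg_sub q p, neg_mul_neg] at hAA'
  have hcA : Commute ((1 - (q - p) * (q - p)) ^ (-(1 / 2) : ℝ)) (intertwiner p q) :=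
    (commute_sub_mul_sub_intertwiner hp hq).cfc_nnreal _
  have hcB : Commute ((1 - (q - p) * (q - p)) ^ (-(1 / 2) : ℝ)) (1 - (q - p) * (q - p)) :=
    (Commute.refl _).cfc_nnreal _
  have hR : star ((1 - (q - p) * (q - p)) ^ (-(1 / 2) : ℝ)) =
      (1 - (q - p) * (q - p)) ^ (-(1 / 2) : ℝ) :=
    (IsSelfAdjoint.of_nonneg CFC.rpow_nonneg).star_eq
  have hRR : (1 - (q - p) * (q - p)) ^ (-(1 / 2) : ℝ) * (1 - (q - p) * (q - p)) ^ (-(1 / 2) : ℝ) *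
      (1 - (q - p) * (q - p)) = 1 := by
    have h1 := CFC.rpow_neg_mul_rpow (a := 1 - (q - p) * (q - p)) 1 hB
    rw [CFC.rpow_one _ hB.nonneg] at h1
    rw [← CFC.rpow_add hB.isUnit]
    -- the exponents add up to `-1`
    norm_num
    exact h1
  rw [Unitary.mem_iff]
  constructor
  · rw [directRotation, star_mul, hR, star_intertwiner hp hq, mul_assoc,
      ← mul_assoc _ (intertwiner p q), hAA,
      ← hcB.eq, ← mul_assoc, hRR]
  · rw [directRotation, star_mul, hR, star_intertwiner hp hq, ← hcA.eq, mul_assoc,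
      ← mul_assoc (intertwiner p q), ← hcA.eq, mul_assoc _ (intertwiner p q), hAA',
      ← mul_assoc, hRR]

theorem continuousOn_directRotation {X : Type*} [TopologicalSpace X] {f : X → A}
    (hf : Continuous f) (hp : IsStarProjection p) (hfp : ∀ x, IsStarProjection (f x)) :
    ContinuousOn (fun x => directRotation p (f x)) {x | ‖f x - p‖ < 1} := by
  unfold directRotation intertwiner
  refine ContinuousOn.mul (by fun_prop) ?_
  exact (CFC.continuousOn_rpow (-(1 / 2))).comp
    (f := fun x => 1 - (f x - p) * (f x - p)) (by fun_prop)
    fun x hx => isStrictlyPositive_one_sub_sq hp (hfp x) hx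

end StarProjection

/-! ### Weak and strong operator topology; the unitary group -/

section Topology

variable {K : Type*} [NormedAddCommGroup K] [InnerProductSpace ℂ K]

/-- A weakly continuous family of vectors whose norm is continuous is continuous in norm. -/
theorem continuous_of_continuous_inner_of_continuous_norm {X : Type*} [TopologicalSpace X]
    {f : X → K} (h : ∀ y, Continuous fun t => ⟪y, f t⟫_ℂ) (hn : Continuous fun t => ‖f t‖) :
    Continuous f := by
  rw [continuous_iff_continuousAt]
  intro t₀
  rw [ContinuousAt, tendsto_iff_norm_sub_tendsto_zero]
  have h1 : Continuous fun t => √(‖f t‖ ^ 2 - 2 * RCLike.re ⟪f t₀, f t⟫_ℂ + ‖f t₀‖ ^ 2) := by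
    have := h (f t₀)
    fun_prop
  have h2 : ∀ t, √(‖f t‖ ^ 2 - 2 * RCLike.re ⟪f t₀, f t⟫_ℂ + ‖f t₀‖ ^ 2) = ‖f t - f t₀‖ := by
    intro t
    rw [inner_re_symm, ← norm_sub_sq, Real.sqrt_sq (norm_nonneg _)]
  rw [funext h2] at h1
  simpa using h1.tendsto t₀

variable [CompleteSpace K]

/-- The weak and strong topologies agree on a set of operators as soon as all evaluations at vectors
are norm continuous for the weak one. -/
theorem induced_weak_eq_induced_strong {X : Type*} (F : X → K →L[ℂ] K)
    (h : ∀ x, Continuous[TopologicalSpace.induced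
      (fun t => ContinuousLinearMapWOT.ofCLM (σ := RingHom.id ℂ) (F t)) inferInstance, inferInstance]
      fun t => F t x) :
    TopologicalSpace.induced
      (fun t => ContinuousLinearMapWOT.ofCLM (σ := RingHom.id ℂ) (F t)) inferInstance =
    TopologicalSpace.induced
      (fun t => ContinuousLinearMap.toPointwiseConvergenceCLM ℂ (RingHom.id ℂ) K K (F t))
      inferInstance := by
  refine le_antisymm ?_ ?_
  · rw [← continuous_iff_le_induced]
    let _ := TopologicalSpace.induced
      (fun t => ContinuousLinearMapWOT.ofCLM (σ := RingHom.id ℂ) (F t)) inferInstance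
    exact PointwiseConvergenceCLM.continuous_of_continuous_eval h
  · rw [← continuous_iff_le_induced]
    let _ := TopologicalSpace.induced
      (fun t => ContinuousLinearMap.toPointwiseConvergenceCLM ℂ (RingHom.id ℂ) K K (F t))
      inferInstance
    rw [ContinuousLinearMapWOT.continuous_iff]
    intro x y
    have : Continuous fun t => F t x :=
      (continuous_eval_const (F := K →Lₚₜ[ℂ] K) x).comp continuous_induced_dom
    exact continuous_const.inner this

namespace UnitaryOp

/-- A unitary element of the algebra of bounded operators, as a point of `UnitaryOp K`. -/
def ofMem (T : K →L[ℂ] K) (hT : T ∈ unitary (K →L[ℂ] K)) : UnitaryOp K := ⟨T, hT⟩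

theorem op_ofMem (T : K →L[ℂ] K) (hT : T ∈ unitary (K →L[ℂ] K)) : (ofMem T hT).op = T := rfl

theorem continuous_iff_inner {X : Type*} [TopologicalSpace X] {f : X → UnitaryOp K} :
    Continuous f ↔ ∀ x y, Continuous fun t => ⟪y, (f t).op x⟫_ℂ :=
  continuous_induced_rng.trans ContinuousLinearMapWOT.continuous_iff

theorem star_op_mul_op (U : UnitaryOp K) : star U.op * U.op = 1 := (Unitary.mem_iff.mp U.op_mem).1

theorem op_mul_star_op (U : UnitaryOp K) : U.op * star U.op = 1 := (Unitary.mem_iff.mp U.op_mem).2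

theorem op_injective : Function.Injective (op : UnitaryOp K → K →L[ℂ] K) := Subtype.val_injective

theorem op_mul (U V : UnitaryOp K) : (U * V).op = U.op * V.op := rfl

theorem op_inv (U : UnitaryOp K) : (U⁻¹).op = star U.op := rfl

theorem norm_op_apply (U : UnitaryOp K) (x : K) : ‖U.op x‖ = ‖x‖ :=
  Unitary.norm_map ⟨U.op, U.op_mem⟩ x

theorem continuous_op_apply (x : K) : Continuous fun U : UnitaryOp K => U.op x :=
  continuous_of_continuous_inner_of_continuous_norm
    (fun y => continuous_iff_inner.mp continuous_id x y)
    (by simpa only [norm_op_apply] using continuous_const)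

theorem weak_eq_strong : UnitaryOp.instTopologicalSpace = UnitaryOp.strongTopology K :=
  induced_weak_eq_induced_strong _ continuous_op_apply

instance : ContinuousInv (UnitaryOp K) where
  continuous_inv := by
    rw [continuous_iff_inner]
    intro x y
    simp only [op_inv, ContinuousLinearMap.star_eq_adjoint, ContinuousLinearMap.adjoint_inner_right]
    exact (continuous_op_apply y).inner continuous_const

instance : IsTopologicalGroup (UnitaryOp K) where
  continuous_mul := by
    rw [continuous_iff_inner]
    intro x y
    have h (p : UnitaryOp K × UnitaryOp K) :
        ⟪y, (p.1 * p.2).op x⟫_ℂ = ⟪(p.1⁻¹).op y, p.2.op x⟫_ℂ := by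
      rw [op_inv, ContinuousLinearMap.star_eq_adjoint, ContinuousLinearMap.adjoint_inner_left]
      rfl
    simp only [h]
    exact ((continuous_op_apply y).comp continuous_fst.inv).inner
      ((continuous_op_apply x).comp continuous_snd)

end UnitaryOp

end Topology

/-! ### Orbit maps with local sections -/

section LocalSections

variable {G B : Type*} [Group G] [TopologicalSpace G] [TopologicalSpace B] {π : G → B}

/-- If the fibres of `π : G → B` are the left cosets of `S` and `π` has local sections, then
`G ⧸ S ≃ₜ B`: near each point, the inverse is a local section followed by the quotient map. -/
theorem exists_quotient_homeomorph_of_local_sections {S : Subgroup G} (hπ : Continuous π)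
    (hfib : ∀ g g', π g = π g' ↔ g⁻¹ * g' ∈ S)
    (hsec : ∀ b, ∃ O ∈ 𝓝 b, ∃ σ : B → G, ContinuousOn σ O ∧ ∀ x ∈ O, π (σ x) = x) :
    ∃ φ : (G ⧸ S) ≃ₜ B, ∀ g, φ (QuotientGroup.mk g) = π g := by
  let f : G ⧸ S → B := Quotient.lift π fun a b hab =>
    (hfib a b).mpr (QuotientGroup.leftRel_apply.mp hab)
  have hf : Function.Bijective f := by
    constructor
    · rintro ⟨a⟩ ⟨b⟩ h
      exact QuotientGroup.eq.mpr ((hfib a b).mp h)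
    · intro b
      obtain ⟨O, hO, σ, -, hσ⟩ := hsec b
      exact ⟨QuotientGroup.mk (σ b), hσ b (mem_of_mem_nhds hO)⟩
  let e := Equiv.ofBijective f hf
  refine ⟨{ e with
    continuous_toFun := hπ.quotient_lift _
    continuous_invFun := ?_ }, fun g => rfl⟩
  rw [continuous_iff_continuousAt]
  intro b
  obtain ⟨O, hO, σ, hσc, hσ⟩ := hsec b
  have h1 : ContinuousAt (fun x => (QuotientGroup.mk (σ x) : G ⧸ S)) b :=
    QuotientGroup.continuous_mk.continuousAt.comp (hσc.continuousAt hO)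
  refine h1.congr ?_
  filter_upwards [hO] with x hx
  exact (e.symm_apply_eq.mpr (hσ x hx).symm).symm

/-- A section `σ` over `O` trivializes `π` over `O`: the point `σ b * j f` has the coordinates
`(b, f)`. -/
theorem exists_trivialization_of_section {F : Type*} [Group F] [TopologicalSpace F]
    [IsTopologicalGroup G] {j : F →* G} (hj : Topology.IsEmbedding j) (hπ : Continuous π)
    (hfib : ∀ g g', π g = π g' ↔ g⁻¹ * g' ∈ j.range) {O : Set B} (hO : IsOpen O) {σ : B → G}
    (hσ : ContinuousOn σ O) (hsec : ∀ b ∈ O, π (σ b) = b) :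
    ∃ e : Bundle.Trivialization F π, e.baseSet = O := by
  have hmem : ∀ g, π g ∈ O → (σ (π g))⁻¹ * g ∈ j.range := fun g hg =>
    (hfib _ _).mp (hsec _ hg)
  have hinv : ∀ g, π g ∈ O → j (Function.invFun j ((σ (π g))⁻¹ * g)) = (σ (π g))⁻¹ * g :=
    fun g hg => Function.invFun_eq (hmem g hg)
  have hproj : ∀ b ∈ O, ∀ f, π (σ b * j f) = b := fun b hb f => by
    refine Eq.trans (Eq.symm ((hfib _ _).mpr ?_)) (hsec b hb)
    exact ⟨f, by group⟩
  refine ⟨{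
    toFun := fun g => (π g, Function.invFun j ((σ (π g))⁻¹ * g))
    invFun := fun x => σ x.1 * j x.2
    source := π ⁻¹' O
    target := O ×ˢ Set.univ
    map_source' := fun g hg => ⟨hg, trivial⟩
    map_target' := fun x hx => by
      simpa [hproj x.1 hx.1] using hx.1
    left_inv' := fun g hg => by simp [hinv g hg]
    right_inv' := fun x hx => by
      ext
      · exact hproj x.1 hx.1 x.2
      · simpa [hproj x.1 hx.1] using Function.leftInverse_invFun hj.injective x.2
    open_source := hO.preimage hπ
    open_target := hO.prod isOpen_univ
    continuousOn_toFun := by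
      refine hπ.continuousOn.prodMk ?_
      rw [hj.isInducing.continuousOn_iff]
      have hσπ : ContinuousOn (fun g => σ (π g)) (π ⁻¹' O) :=
        hσ.comp hπ.continuousOn fun _ h => h
      exact (hσπ.inv.mul continuousOn_id).congr fun g hg => hinv g hg
    continuousOn_invFun := by
      refine ContinuousOn.mul (hσ.comp continuousOn_fst fun x hx => hx.1) ?_
      exact (hj.continuous.comp continuous_snd).continuousOn
    baseSet := O
    open_baseSet := hO
    source_eq := rfl
    target_eq := rfl
    proj_toFun := fun _ _ => rfl }, rfl⟩

end LocalSections

/-! ### Block diagonal unitaries -/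

section Block

variable {K : Type*} [NormedAddCommGroup K] [InnerProductSpace ℂ K]
  (v : Submodule ℂ K) [CompleteSpace v]

theorem blockOp_apply_of_mem (a : v →L[ℂ] v) (b : vᗮ →L[ℂ] vᗮ) (x : v) :
    blockOp v a b x = a x := by
  have h : vᗮ.orthogonalProjectionOnto (x : K) = 0 :=
    Submodule.orthogonalProjectionOnto_orthogonal_apply_eq_zero x.2
  simp [blockOp, h]

theorem blockOp_apply_of_mem_orthogonal (a : v →L[ℂ] v) (b : vᗮ →L[ℂ] vᗮ) (x : vᗮ) :
    blockOp v a b x = b x := by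
  have h : v.orthogonalProjectionOnto (x : K) = 0 :=
    Submodule.orthogonalProjectionOnto_apply_of_mem_orthogonal x.2
  simp [blockOp, h]

theorem blockOp_one_zero : blockOp v 1 0 = v.starProjection := by
  ext x
  simp [blockOp]

theorem blockOp_inj {a a' : v →L[ℂ] v} {b b' : vᗮ →L[ℂ] vᗮ}
    (h : blockOp v a b = blockOp v a' b') : a = a' ∧ b = b' := by
  constructor
  · ext x
    rw [← blockOp_apply_of_mem v a b, h, blockOp_apply_of_mem]
  · ext x
    rw [← blockOp_apply_of_mem_orthogonal v a b, h, blockOp_apply_of_mem_orthogonal]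

/-- An operator commuting with the projection onto `v` is block diagonal; its blocks are its
compressions to `v` and `vᗮ`. -/
theorem exists_blockOp_eq_of_commute {T : K →L[ℂ] K} (hT : Commute T v.starProjection) :
    ∃ a b, blockOp v a b = T := by
  refine ⟨v.orthogonalProjectionOnto ∘L T ∘L v.subtypeL,
    vᗮ.orthogonalProjectionOnto ∘L T ∘L vᗮ.subtypeL, ?_⟩
  have h1 : ∀ x, T (v.starProjection x) = v.starProjection (T x) := fun x => DFunLike.congr_fun hT x
  ext x
  have h2 : v.starProjection (v.starProjection (T x)) = v.starProjection (T x) :=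
    DFunLike.congr_fun v.isIdempotentElem_starProjection (T x)
  simp [blockOp, h1, h2]

variable [CompleteSpace K]

theorem commute_blockOp_starProjection (a : v →L[ℂ] v) (b : vᗮ →L[ℂ] vᗮ) :
    Commute (blockOp v a b) v.starProjection := by
  rw [← blockOp_one_zero]
  change _ * _ = _ * _
  simp [blockOp_mul]

/-- The unitaries `a ⊕ b` are those commuting with the projection onto `v`. The blocks of a block
diagonal unitary are unitary because `a ⊕ b` determines `a` and `b`. -/
theorem mem_range_blockHom_iff {U : UnitaryOp K} :
    U ∈ (blockHom v).range ↔ Commute U.op v.starProjection := by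
  constructor
  · rintro ⟨p, rfl⟩
    exact commute_blockOp_starProjection v _ _
  · intro h
    obtain ⟨a, b, hab⟩ := exists_blockOp_eq_of_commute v h
    have h1 := U.star_op_mul_op
    have h2 := U.op_mul_star_op
    rw [← hab, star_blockOp, blockOp_mul, ← blockOp_one v] at h1 h2
    obtain ⟨ha1, hb1⟩ := blockOp_inj v h1
    obtain ⟨ha2, hb2⟩ := blockOp_inj v h2
    exact ⟨(⟨a, Unitary.mem_iff.mpr ⟨ha1, ha2⟩⟩, ⟨b, Unitary.mem_iff.mpr ⟨hb1, hb2⟩⟩),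
      UnitaryOp.op_injective hab⟩

theorem op_blockHom (p : UnitaryOp v × UnitaryOp vᗮ) :
    (blockHom v p).op = blockOp v p.1.op p.2.op := rfl

/-- The map `(a, b) ↦ a ⊕ b` is an embedding for the weak operator topologies: the matrix elements of
`a` and `b` are among those of `a ⊕ b`. -/
theorem isEmbedding_blockHom : Topology.IsEmbedding (blockHom v) := by
  refine ⟨⟨le_antisymm ?_ ?_⟩, ?_⟩
  · rw [← continuous_iff_le_induced, UnitaryOp.continuous_iff_inner]
    intro x y
    have h1 := (UnitaryOp.continuous_op_apply (v.orthogonalProjectionOnto x)).comp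
      (continuous_fst (X := UnitaryOp v) (Y := UnitaryOp vᗮ))
    have h2 := (UnitaryOp.continuous_op_apply (vᗮ.orthogonalProjectionOnto x)).comp
      (continuous_snd (X := UnitaryOp v) (Y := UnitaryOp vᗮ))
    exact continuous_const.inner
      ((v.subtypeL.continuous.comp h1).add (vᗮ.subtypeL.continuous.comp h2))
  · rw [← continuous_id_iff_le]
    let _ := TopologicalSpace.induced (blockHom v) inferInstance
    have hc : ∀ x : K, Continuous fun p => (blockHom v p).op x := fun x =>
      (UnitaryOp.continuous_op_apply x).comp continuous_induced_dom
    refine continuous_prodMk.mpr ⟨UnitaryOp.continuous_iff_inner.mpr fun x y => ?_,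
      UnitaryOp.continuous_iff_inner.mpr fun x y => ?_⟩
    · have := (continuous_const (y := (y : K))).inner (𝕜 := ℂ) (hc x)
      simpa only [op_blockHom, blockOp_apply_of_mem, ← Submodule.coe_inner] using this
    · have := (continuous_const (y := (y : K))).inner (𝕜 := ℂ) (hc x)
      simpa only [op_blockHom, blockOp_apply_of_mem_orthogonal, ← Submodule.coe_inner] using this
  · intro p q h
    obtain ⟨h1, h2⟩ := blockOp_inj v (congrArg UnitaryOp.op h)
    exact Prod.ext (UnitaryOp.op_injective h1) (UnitaryOp.op_injective h2)

end Block

/-! ### Points of the Grassmannian -/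

namespace Grassmannian

variable {K : Type*} [NormedAddCommGroup K] [InnerProductSpace ℂ K] [CompleteSpace K] {n : ℕ}

theorem isStarProjection (P : Grassmannian K n) : IsStarProjection P.op := P.2.1

theorem op_injective : Function.Injective (op : Grassmannian K n → K →L[ℂ] K) :=
  Subtype.val_injective

theorem op_op_apply (P : Grassmannian K n) (x : K) : P.op (P.op x) = P.op x :=
  DFunLike.congr_fun P.isStarProjection.isIdempotentElem x

theorem mem_ran_iff {P : Grassmannian K n} {x : K} : x ∈ P.ran ↔ P.op x = x := by
  constructor
  · rintro ⟨y, rfl⟩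
    exact P.op_op_apply y
  · exact fun h => ⟨x, h⟩

theorem op_apply_mem_ran (P : Grassmannian K n) (x : K) : P.op x ∈ P.ran := ⟨x, rfl⟩

theorem finrank_ran (P : Grassmannian K n) : Module.finrank ℂ P.ran = n :=
  Module.finrank_eq_of_rank_eq P.2.2

theorem starProjection_ran (P : Grassmannian K n) : P.ran.starProjection = P.op :=
  ContinuousLinearMap.IsStarProjection.ext isStarProjection_starProjection P.isStarProjection
    P.ran.range_starProjection

theorem eq_of_ran_le {P Q : Grassmannian K n} (h : P.ran ≤ Q.ran) : P = Q := by
  have h1 : P.ran = Q.ran :=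
    Submodule.eq_of_le_of_finrank_eq h (P.finrank_ran.trans Q.finrank_ran.symm)
  exact op_injective (ContinuousLinearMap.IsStarProjection.ext P.isStarProjection
    Q.isStarProjection h1)

/-! ### Topology of the Grassmannian -/

theorem continuous_inner_op_apply (x y : K) :
    Continuous fun P : Grassmannian K n => ⟪y, P.op x⟫_ℂ :=
  ContinuousLinearMapWOT.continuous_iff.mp
    (continuous_induced_dom (f := fun P : Grassmannian K n =>
      ContinuousLinearMapWOT.ofCLM (σ := RingHom.id ℂ) P.op)) x y

theorem norm_op_apply (P : Grassmannian K n) (x : K) :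
    ‖P.op x‖ = √(RCLike.re ⟪x, P.op x⟫_ℂ) := by
  have h : ⟪x, P.op x⟫_ℂ = ⟪P.op x, P.op x⟫_ℂ := by
    conv_rhs => rw [← ContinuousLinearMap.adjoint_inner_right, ← ContinuousLinearMap.star_eq_adjoint,
      P.isStarProjection.isSelfAdjoint.star_eq, op_op_apply]
  rw [h, inner_self_eq_norm_sq, Real.sqrt_sq (norm_nonneg _)]

theorem continuous_op_apply (x : K) : Continuous fun P : Grassmannian K n => P.op x :=
  continuous_of_continuous_inner_of_continuous_norm (continuous_inner_op_apply x) (by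
    simp only [norm_op_apply]
    exact Real.continuous_sqrt.comp
      (RCLike.continuous_re.comp (continuous_inner_op_apply x x)))

theorem weak_eq_strong :
    Grassmannian.instTopologicalSpace = Grassmannian.strongTopology K n :=
  induced_weak_eq_induced_strong _ continuous_op_apply

/-- If `δ = ‖QP - P‖ ≤ 1/2`, then `Q` maps the range of `P` injectively, hence by equality of the
(finite) dimensions onto the range of `Q`. So each `y` in the range of `Q` is `Q x` with `x` in the
range of `P`, `‖x‖ ≤ 2‖y‖` and `‖y - x‖ ≤ 2δ‖y‖`; this bounds `‖Q - PQ‖` by `2δ`. -/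
theorem norm_op_sub_op_le {P Q : Grassmannian K n} (h : ‖Q.op * P.op - P.op‖ ≤ 1 / 2) :
    ‖Q.op - P.op‖ ≤ 3 * ‖Q.op * P.op - P.op‖ := by
  set δ := ‖Q.op * P.op - P.op‖ with hδ
  have hδ0 : 0 ≤ δ := norm_nonneg _
  have hδx : ∀ x ∈ P.ran, ‖Q.op x - x‖ ≤ δ * ‖x‖ := fun x hx => by
    have := (Q.op * P.op - P.op).le_opNorm x
    simpa [mem_ran_iff.mp hx] using this
  have hnorm : ∀ (R : Grassmannian K n) (x : K), ‖R.op x‖ ≤ ‖x‖ := fun R x => by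
    simpa using R.op.le_of_opNorm_le R.isStarProjection.norm_le x
  have hnorm' : ∀ x, ‖x - P.op x‖ ≤ ‖x‖ := fun x => by
    simpa using (1 - P.op).le_of_opNorm_le P.isStarProjection.one_sub.norm_le x
  let T : P.ran →ₗ[ℂ] Q.ran :=
    ((Q.op : K →ₗ[ℂ] K) ∘ₗ P.ran.subtype).codRestrict Q.ran fun x => Q.op_apply_mem_ran x
  have hT : Function.Injective T := by
    rw [← LinearMap.ker_eq_bot, LinearMap.ker_eq_bot']
    intro x hx
    have h0 : Q.op (x : K) = 0 := congrArg Subtype.val hx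
    have h1 := hδx x x.2
    rw [h0, zero_sub, norm_neg] at h1
    have : ‖(x : K)‖ = 0 := by nlinarith [norm_nonneg (x : K)]
    exact Subtype.ext (norm_eq_zero.mp this)
  have hTs : Function.Surjective T :=
    (LinearMap.injective_iff_surjective_of_finrank_eq_finrank
      (P.finrank_ran.trans Q.finrank_ran.symm)).mp hT
  have hQ : ∀ y ∈ Q.ran, ‖y - P.op y‖ ≤ 2 * δ * ‖y‖ := fun y hy => by
    obtain ⟨x, hx⟩ := hTs ⟨y, hy⟩
    have hx1 : Q.op (x : K) = y := congrArg Subtype.val hx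
    have h1 := hδx x x.2
    have h2 : ‖(x : K)‖ ≤ 2 * ‖y‖ := by
      have : ‖(x : K)‖ ≤ ‖y‖ + ‖Q.op (x : K) - x‖ := by
        calc ‖(x : K)‖ = ‖y - (Q.op (x : K) - x)‖ := by rw [hx1]; simp
          _ ≤ _ := norm_sub_le _ _
      nlinarith [norm_nonneg (x : K)]
    have h3 : y - P.op y = (Q.op (x : K) - x) - P.op (Q.op (x : K) - x) := by
      rw [map_sub, mem_ran_iff.mp x.2, hx1]; abel
    calc ‖y - P.op y‖ ≤ ‖Q.op (x : K) - x‖ := by rw [h3]; exact hnorm' _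
      _ ≤ δ * ‖(x : K)‖ := h1
      _ ≤ 2 * δ * ‖y‖ := by nlinarith
  -- the adjoint of `QP - P`
  have hadj : ‖P.op * Q.op - P.op‖ = δ := by
    rw [hδ, ← norm_star]
    simp [P.isStarProjection.isSelfAdjoint.star_eq, Q.isStarProjection.isSelfAdjoint.star_eq]
  have h4 : ‖Q.op - P.op * Q.op‖ ≤ 2 * δ := by
    refine ContinuousLinearMap.opNorm_le_bound _ (by positivity) fun x => ?_
    calc ‖Q.op x - P.op (Q.op x)‖ ≤ 2 * δ * ‖Q.op x‖ := hQ _ (Q.op_apply_mem_ran x)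
      _ ≤ 2 * δ * ‖x‖ := by gcongr; exact hnorm Q x
  calc ‖Q.op - P.op‖ = ‖(Q.op - P.op * Q.op) + (P.op * Q.op - P.op)‖ := by abel_nf
    _ ≤ 2 * δ + δ := (norm_add_le _ _).trans (add_le_add h4 hadj.le)
    _ = 3 * δ := by ring

/-- The weak operator topology on the Grassmannian of finite rank `n` is the norm topology: the map
`Q ↦ QP` only depends on the values of `Q` on a finite-dimensional space, so it is norm continuous,
and it controls `Q - P` by `norm_op_sub_op_le`. -/
theorem continuous_op : Continuous (op : Grassmannian K n → K →L[ℂ] K) := by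
  rw [continuous_iff_continuousAt]
  intro P
  rw [ContinuousAt, tendsto_iff_norm_sub_tendsto_zero]
  have h1 : Continuous fun Q : Grassmannian K n => Q.op ∘L P.ran.subtypeL :=
    continuous_clm_apply.mpr fun y => continuous_op_apply (y : K)
  have h2 : Continuous fun Q : Grassmannian K n => ‖Q.op * P.op - P.op‖ := by
    have h3 : ∀ Q : Grassmannian K n, Q.op * P.op =
        (Q.op ∘L P.ran.subtypeL) ∘L P.ran.orthogonalProjectionOnto := fun Q => by
      rw [← P.starProjection_ran]
      rfl
    simp only [h3]
    exact ((h1.clm_comp continuous_const).sub continuous_const).norm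
  have h4 := h2.tendsto P
  rw [P.isStarProjection.isIdempotentElem.eq, sub_self, norm_zero] at h4
  refine squeeze_zero' (.of_forall fun _ => norm_nonneg _) ?_ (by simpa using h4.const_mul 3)
  filter_upwards [h4.eventually_le_const (by norm_num : (0 : ℝ) < 1 / 2)] with Q hQ
  exact norm_op_sub_op_le hQ

/-! ### The orbit map and its local sections -/

theorem op_orbitMap (P : Grassmannian K n) (U : UnitaryOp K) :
    (P.orbitMap U).op = U.op * P.op * star U.op := rfl

theorem orbitMap_eq_iff {P Q : Grassmannian K n} {U : UnitaryOp K} :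
    P.orbitMap U = Q ↔ U.op * P.op = Q.op * U.op := by
  rw [← op_injective.eq_iff, op_orbitMap]
  constructor
  · rintro h
    rw [← h, mul_assoc _ _ U.op, U.star_op_mul_op, mul_one]
  · intro h
    rw [h, mul_assoc, U.op_mul_star_op, mul_one]

theorem orbitMap_mul (P : Grassmannian K n) (U V : UnitaryOp K) :
    P.orbitMap (U * V) = (P.orbitMap V).orbitMap U :=
  op_injective (by simp only [op_orbitMap, UnitaryOp.op_mul, star_mul, mul_assoc])

theorem orbitMap_one (P : Grassmannian K n) : P.orbitMap 1 = P :=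
  orbitMap_eq_iff.mpr ((one_mul P.op).trans (mul_one P.op).symm)

theorem orbitMap_eq_orbitMap_iff (P : Grassmannian K n) (U V : UnitaryOp K) :
    P.orbitMap U = P.orbitMap V ↔ U⁻¹ * V ∈ (blockHom P.ran).range := by
  rw [mem_range_blockHom_iff, starProjection_ran, commute_iff_eq, ← orbitMap_eq_iff, orbitMap_mul]
  constructor
  · intro h
    rw [← h, ← orbitMap_mul, inv_mul_cancel, orbitMap_one]
  · intro h
    conv_lhs => rw [← h, ← orbitMap_mul, mul_inv_cancel, orbitMap_one]

theorem continuous_orbitMap (P : Grassmannian K n) : Continuous P.orbitMap := by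
  refine continuous_induced_rng.mpr (ContinuousLinearMapWOT.continuous_iff.mpr fun x y => ?_)
  have h : ∀ U : UnitaryOp K, ⟪y, (P.orbitMap U).op x⟫_ℂ =
      ⟪(U⁻¹).op y, P.op ((U⁻¹).op x)⟫_ℂ := fun U => by
    simp only [UnitaryOp.op_inv, ContinuousLinearMap.star_eq_adjoint,
      ContinuousLinearMap.adjoint_inner_left]
    rfl
  have hc : ∀ x : K, Continuous fun U : UnitaryOp K => (U⁻¹).op x := fun x =>
    (UnitaryOp.continuous_op_apply x).comp continuous_inv
  exact ((hc y).inner (P.op.continuous.comp (hc x))).congr fun U => (h U).symm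

/-- The unitary group acts transitively: an isometry from the range of `P` onto that of `Q` extends
to the finite-dimensional space `W` spanned by both ranges, and by the identity on `Wᗮ`. -/
theorem exists_orbitMap_eq (P Q : Grassmannian K n) : ∃ U : UnitaryOp K, P.orbitMap U = Q := by
  let W : Submodule ℂ K := P.ran ⊔ Q.ran
  have hP : P.ran ≤ W := le_sup_left
  have hQ : Q.ran ≤ W := le_sup_right
  let e : P.ran ≃ₗᵢ[ℂ] Q.ran :=
    (stdOrthonormalBasis ℂ P.ran).equiv (stdOrthonormalBasis ℂ Q.ran)
      (finCongr (P.finrank_ran.trans Q.finrank_ran.symm))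
  let L : P.ran.comap W.subtype →ₗᵢ[ℂ] W :=
    { toLinearMap := Submodule.inclusion hQ ∘ₗ e.toLinearEquiv.toLinearMap ∘ₗ
        (Submodule.comapSubtypeEquivOfLe hP).toLinearMap
      norm_map' := fun x => by
        change ‖e (Submodule.comapSubtypeEquivOfLe hP x)‖ = _
        rw [e.norm_map]
        rfl }
  let V : W ≃ₗᵢ[ℂ] W := L.extend.toLinearIsometryEquiv rfl
  let VU : unitary (W →L[ℂ] W) := Unitary.linearIsometryEquiv.symm V
  let U : UnitaryOp K := blockHom W (.ofMem VU.1 VU.2, 1)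
  have hU : ∀ y ∈ P.ran, U.op y ∈ Q.ran := fun y hy => by
    have h1 : U.op y = (L.extend ⟨y, hP hy⟩ : W) := blockOp_apply_of_mem W _ _ ⟨y, hP hy⟩
    have h2 : L.extend ⟨y, hP hy⟩ = L ⟨⟨y, hP hy⟩, hy⟩ := L.extend_apply ⟨⟨y, hP hy⟩, hy⟩
    rw [h1, h2]
    exact (e ⟨y, hy⟩).2
  refine ⟨U, eq_of_ran_le ?_⟩
  rintro _ ⟨x, rfl⟩
  exact hU _ (P.op_apply_mem_ran _)

/-- The direct rotation from `P` to `Q` as a unitary operator, set to `1` if `‖Q - P‖ ≥ 1`. -/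
def rotation (P Q : Grassmannian K n) : UnitaryOp K :=
  open Classical in
  if h : ‖Q.op - P.op‖ < 1 then
    .ofMem (directRotation P.op Q.op)
      (directRotation_mem_unitary P.isStarProjection Q.isStarProjection h)
  else 1

theorem op_rotation {P Q : Grassmannian K n} (h : ‖Q.op - P.op‖ < 1) :
    (rotation P Q).op = directRotation P.op Q.op := by
  rw [rotation, dif_pos h, UnitaryOp.op_ofMem]

theorem orbitMap_rotation {P Q : Grassmannian K n} (h : ‖Q.op - P.op‖ < 1) :
    P.orbitMap (rotation P Q) = Q := by
  rw [orbitMap_eq_iff, op_rotation h]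
  exact directRotation_mul P.isStarProjection Q.isStarProjection

theorem continuousOn_rotation (P : Grassmannian K n) :
    ContinuousOn (rotation P) {Q | ‖Q.op - P.op‖ < 1} := by
  rw [continuousOn_iff_continuous_domRestrict, UnitaryOp.continuous_iff_inner]
  intro x y
  have h := (continuousOn_directRotation (p := P.op) continuous_op P.isStarProjection
    (fun Q : Grassmannian K n => Q.isStarProjection)).domRestrict
  have h2 : ∀ Q : {Q : Grassmannian K n | ‖Q.op - P.op‖ < 1},
      (rotation P Q).op = directRotation P.op (Q : Grassmannian K n).op := fun Q => op_rotation Q.2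
  simp only [Set.domRestrict_apply, h2]
  exact continuous_const.inner (h.clm_apply continuous_const)

theorem exists_local_section (P₀ P : Grassmannian K n) :
    ∃ O : Set (Grassmannian K n), IsOpen O ∧ P ∈ O ∧ ∃ σ : Grassmannian K n → UnitaryOp K,
      ContinuousOn σ O ∧ ∀ Q ∈ O, P₀.orbitMap (σ Q) = Q := by
  obtain ⟨V, hV⟩ := exists_orbitMap_eq P₀ P
  refine ⟨{Q | ‖Q.op - P.op‖ < 1}, ?_, by simp, fun Q => rotation P Q * V,
    (continuousOn_rotation P).mul continuousOn_const, fun Q hQ => ?_⟩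
  · exact isOpen_lt (continuous_op.sub continuous_const).norm continuous_const
  · rw [orbitMap_mul, hV, orbitMap_rotation hQ]

end Grassmannian

end

theorem proposition3p1 {h : Type*} [NormedAddCommGroup h] [InnerProductSpace ℂ h] [CompleteSpace h]
    [TopologicalSpace.SeparableSpace h] (hinf : ¬ FiniteDimensional ℂ h)
    (n : ℕ) (P₀ : Grassmannian h n) :
    -- `U ↦ U P₀ U*` is a locally trivial fibre bundle, for the weak topologies
    IsLocallyTrivialFibreBundle (UnitaryOp P₀.ran × UnitaryOp P₀.ranᗮ)
      (P₀.orbitMap : UnitaryOp h → Grassmannian h n) ∧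
    -- it induces a homeomorphism of the quotient onto the Grassmannian
    (∃ φ : (UnitaryOp h ⧸ blockSubgroup P₀.ran) ≃ₜ Grassmannian h n,
      ∀ U : UnitaryOp h, φ (QuotientGroup.mk U) = P₀.orbitMap U) ∧
    -- the weak and the strong topology agree on all the spaces involved
    (UnitaryOp.instTopologicalSpace = UnitaryOp.strongTopology h ∧
      UnitaryOp.instTopologicalSpace = UnitaryOp.strongTopology P₀.ran ∧
      UnitaryOp.instTopologicalSpace = UnitaryOp.strongTopology P₀.ranᗮ ∧
      Grassmannian.instTopologicalSpace = Grassmannian.strongTopology h n) := by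
  refine ⟨⟨P₀.continuous_orbitMap, fun P => ?_⟩, ?_, UnitaryOp.weak_eq_strong,
    UnitaryOp.weak_eq_strong, UnitaryOp.weak_eq_strong, Grassmannian.weak_eq_strong⟩
  · obtain ⟨O, hO, hP, σ, hσ, hsec⟩ := P₀.exists_local_section P
    obtain ⟨e, he⟩ := exists_trivialization_of_section (isEmbedding_blockHom P₀.ran)
      P₀.continuous_orbitMap P₀.orbitMap_eq_orbitMap_iff hO hσ hsec
    exact ⟨e, he ▸ hP⟩
  · refine exists_quotient_homeomorph_of_local_sections P₀.continuous_orbitMap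
      P₀.orbitMap_eq_orbitMap_iff fun P => ?_
    obtain ⟨O, hO, hP, σ, hσ, hsec⟩ := P₀.exists_local_section P
    exact ⟨O, hO.mem_nhds hP, σ, hσ, hsec⟩
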